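/- Let $S^1=\Delta[1]/\partial\Delta[1]$ be the simplicial circle and let $F(S^1)$ be Milnor's construction on it, that is, the simplicial group which in degree $m$ is the free group on the set $(S^1)_m$ modulo the relation that the base point is $1$. For $0\le i\le m+1$ let $x_i\in F(S^1)_m$ be the class of the $m$-simplex of $\Delta[1]$ that takes $i$ times the value $0$ and $m+1-i$ times the value $1$ (so $x_0=x_{m+1}=1$), and put $y_{k}=x_{k+1}x_{k+2}^{-1}$ for $-1\le k\le m-1$; then $F(S^1)_m$ is free on $y_0,\dots,y_{m-1}$, and $y_{-1}=(y_0\cdots y_{m-1})^{-1}$. The braid group $B_{m+1}$ with Artin generators $\sigma_{-1},\sigma_0,\dots,\sigma_{m-2}$ acts on $F(S^1)_m$ by automorphisms with $$\sigma_k(y_k)=y_{k+1},\qquad \sigma_k(y_{k+1})=y_{k+1}^{-1}y_ky_{k+1},\qquad \sigma_k(y_j)=y_j\ \ (j\ne k,k+1).$$ For a simplicial group $G$ put $\mathcal Z_m(G)=\{x\in G_m\mid d_jx=1\text{ for all }j\}$, $\mathcal B_m(G)=\{d_0x\mid x\in G_{m+1},\ d_jx=1\text{ for all }j>0\}$ and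 $\pi_m(G)=\mathcal Z_m(G)/\mathcal B_m(G)$. The subgroup $\mathcal B_m(F(S^1))$ is normal in $F(S^1)_m$ and invariant under $B_{m+1}$, so $B_{m+1}$ acts on $F(S^1)_m/\mathcal B_m(F(S^1))$. Let $K_m$ denote the pure braid group, the kernel of $B_m\to\Sigma_m$. Let $n\ge 2$. Consider the action of $B_{n+2}$ on $F(S^1)_{n+1}/\mathcal B_{n+1}(F(S^1))$ and of its subgroup $B_{n+1}$ generated by $\sigma_0,\dots,\sigma_{n-1}$. The canonical map $\pi_{n+1}(F(S^1))\to F(S^1)_{n+1}/\mathcal B_{n+1}(F(S^1))$ is injective, and, regarding $\pi_{n+1}(F(S^1))$ as a subgroup through it: 1. the fixed set of $K_{n+1}$ is $\mathbb Z\oplus\pi_{n+1}(F(S^1))$; more precisely, $(k,z)\mapsto y_{-1}^{\,k}z$ is a group isomorphism of $\mathbb Z\times\pi_{n+1}(F(S^1))$ onto the fixed set; 2. the fixed set of $K_{n+2}$ is exactly $\pi_{n+1}(F(S^1))$. -/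

import Mathlib

/-! ### Braid groups -/

/-- The Artin relations of the braid group on `m` strands, in the generators
`σ₀, …, σ_{m-2}`. -/
inductive BraidRel (m : ℕ) : FreeGroup (Fin (m - 1)) → Prop
  | braid (i j : Fin (m - 1)) (h : (i : ℕ) + 1 = j) :
      BraidRel m (FreeGroup.of i * FreeGroup.of j * FreeGroup.of i *
        (FreeGroup.of j * FreeGroup.of i * FreeGroup.of j)⁻¹)
  | comm (i j : Fin (m - 1)) (h : (i : ℕ) + 2 ≤ j) :
      BraidRel m (FreeGroup.of i * FreeGroup.of j * (FreeGroup.of j * FreeGroup.of i)⁻¹)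

/-- The Artin braid group on `m` strands. -/
abbrev BraidGroup (m : ℕ) : Type := PresentedGroup {r | BraidRel m r}

namespace BraidGroup

/-- A homomorphism out of the braid group from images of the generators satisfying the
Artin relations. -/
def lift {m : ℕ} {H : Type*} [Group H] (f : Fin (m - 1) → H)
    (hb : ∀ i j : Fin (m - 1), (i : ℕ) + 1 = j → f i * f j * f i = f j * f i * f j)
    (hc : ∀ i j : Fin (m - 1), (i : ℕ) + 2 ≤ j → f i * f j = f j * f i) :
    BraidGroup m →* H :=
  PresentedGroup.toGroup (f := f) (by
    rintro r (⟨i, j, h⟩ | ⟨i, j, h⟩)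
    · simp only [map_mul, map_inv, FreeGroup.lift_apply_of, mul_inv_eq_one]
      exact hb i j h
    · simp only [map_mul, map_inv, FreeGroup.lift_apply_of, mul_inv_eq_one]
      exact hc i j h)

/-- The `i`-th Artin generator. -/
def gen {m : ℕ} (i : Fin (m - 1)) : BraidGroup m := PresentedGroup.of i

@[simp]
lemma lift_gen {m : ℕ} {H : Type*} [Group H] (f : Fin (m - 1) → H) (hb hc) (i : Fin (m - 1)) :
    lift f hb hc (gen i) = f i :=
  PresentedGroup.toGroup.of _

lemma gen_braid {m : ℕ} (i j : Fin (m - 1)) (h : (i : ℕ) + 1 = j) :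
    gen i * gen j * gen i = gen j * gen i * gen j := by
  have := PresentedGroup.one_of_mem (rels := {r | BraidRel m r}) (BraidRel.braid i j h)
  simp only [map_mul, map_inv, mul_inv_eq_one] at this
  exact this

lemma gen_comm {m : ℕ} (i j : Fin (m - 1)) (h : (i : ℕ) + 2 ≤ j) :
    gen i * gen j = gen j * gen i := by
  have := PresentedGroup.one_of_mem (rels := {r | BraidRel m r}) (BraidRel.comm i j h)
  simp only [map_mul, map_inv, mul_inv_eq_one] at this
  exact this

/-- The canonical homomorphism `B_m → Σ_m`; the `i`-th generator goes to the transposition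
`(i, i + 1)`. -/
def toPerm (m : ℕ) : BraidGroup m →* Equiv.Perm (Fin m) :=
  lift (fun i => Equiv.swap ⟨i, by omega⟩ ⟨i + 1, by omega⟩)
    (by
      intro i j h
      ext k
      simp only [Equiv.Perm.mul_apply, Equiv.swap_apply_def, Fin.ext_iff]
      grind)
    (by
      intro i j h
      ext k
      simp only [Equiv.Perm.mul_apply, Equiv.swap_apply_def, Fin.ext_iff]
      grind)

/-- The pure braid group `K_m`. -/
def pure (m : ℕ) : Subgroup (BraidGroup m) := (toPerm m).ker

/-- The homomorphism `B_m → B_{m+1}` onto the subgroup generated by all the generators except the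
first one. -/
def shift (m : ℕ) : BraidGroup m →* BraidGroup (m + 1) :=
  lift (fun i => gen ⟨i + 1, by omega⟩)
    (fun _ _ h => gen_braid _ _ (by simpa using h))
    (fun _ _ h => gen_comm _ _ (by simp only; omega))

end BraidGroup

/-! ### Simplicial groups: cycles, boundaries, homotopy groups -/

section

open CategoryTheory Opposite

namespace SimplicialGroup

variable (G : SimplicialObject GrpCat.{0})

/-- `NG_n`: the simplices all of whose faces `d_j` with `j > 0` are trivial. -/
def moore : (n : ℕ) → Subgroup (G.obj (op (.mk n)))
  | 0 => ⊤
  | n + 1 => ⨅ j : Fin (n + 1), (G.δ j.succ).hom.ker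

/-- `𝒵_n(G)`: the simplices all of whose faces are trivial. -/
def cycles : (n : ℕ) → Subgroup (G.obj (op (.mk n)))
  | 0 => ⊤
  | n + 1 => ⨅ j : Fin (n + 2), (G.δ j).hom.ker

/-- `ℬ_n(G) = d_0(NG_{n+1})`. -/
def boundaries (n : ℕ) : Subgroup (G.obj (op (.mk n))) := (moore G (n + 1)).map (G.δ 0).hom

lemma mem_moore_succ {n : ℕ} (x : G.obj (op (.mk (n + 1)))) :
    x ∈ moore G (n + 1) ↔ ∀ j : Fin (n + 1), G.δ j.succ x = 1 := by
  simp [moore, Subgroup.mem_iInf, MonoidHom.mem_ker]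

instance boundaries_normal (n : ℕ) : (boundaries G n).Normal := by
  have : (moore G (n + 1)).Normal := Subgroup.normal_iInf_normal fun j => inferInstance
  refine this.map _ fun x => ⟨G.σ 0 x, ?_⟩
  have := ConcreteCategory.congr_hom (G.δ_comp_σ_self (i := (0 : Fin (n + 1)))) x
  simpa using this

/-- `π_n(G) = 𝒵_n(G) / ℬ_n(G)`. -/
abbrev homotopyGroup (n : ℕ) : Type :=
  cycles G n ⧸ (boundaries G n).subgroupOf (cycles G n)

/-- The quotient `G_n / ℬ_n(G)`. -/
abbrev modBoundaries (n : ℕ) : Type := G.obj (op (.mk n)) ⧸ boundaries G n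

/-- The inclusion `π_n(G) = 𝒵_n(G) / ℬ_n(G) → G_n / ℬ_n(G)`. -/
def homotopyIncl (n : ℕ) : homotopyGroup G n →* modBoundaries G n :=
  QuotientGroup.map _ _ (cycles G n).subtype le_rfl

end SimplicialGroup

/-! ### Milnor's construction on the simplicial circle -/

open Simplicial

/-- The quotient simplicial set `X / A`: all the simplices of `A` are identified in each degree. -/
def SSet.collapse (X : SSet.{0}) (A : X.Subcomplex) : SSet.{0} where
  obj n := Quot fun a b : X.obj n => a ∈ A.obj n ∧ b ∈ A.obj n
  map f := ↾(Quot.map (X.map f) fun _ _ h => ⟨A.map f h.1, A.map f h.2⟩)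
  map_id n := by
    ext ⟨a⟩
    exact congrArg (Quot.mk _) (by simp)
  map_comp f g := by
    ext ⟨a⟩
    exact congrArg (Quot.mk _) (by simp)

/-- Milnor's construction on a simplicial set `X` pointed at the vertex `pt`: in degree `n` it is
the free group on `X_n` modulo the relation that the (degenerate) base point is `1`. -/
def milnorF (X : SSet.{0}) (pt : X _⦋0⦌) : SimplicialObject GrpCat.{0} where
  obj n := GrpCat.of (FreeGroup (X.obj n) ⧸
    Subgroup.normalClosure {FreeGroup.of (X.map (SimplexCategory.const n.unop ⦋0⦌ 0).op pt)})
  map {n m} f := GrpCat.ofHom (QuotientGroup.map _ _ (FreeGroup.map (X.map f)) (by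
    refine Subgroup.normalClosure_le_normal ?_
    rintro _ rfl
    refine Subgroup.subset_normalClosure ?_
    have h : (SimplexCategory.const n.unop ⦋0⦌ 0).op ≫ f =
        (SimplexCategory.const m.unop ⦋0⦌ 0).op := Quiver.Hom.unop_inj (by ext; rfl)
    rw [← h]
    simp))
  map_id n := by
    ext x
    simp
  map_comp f g := by
    ext x
    simp

/-- The simplicial circle `S¹ = Δ[1] / ∂Δ[1]`. -/
def simplicialCircle : SSet.{0} := SSet.collapse Δ[1] ∂Δ[1]

/-- The base point of the simplicial circle. -/
def simplicialCircle.pt : simplicialCircle _⦋0⦌ := Quot.mk _ (SSet.stdSimplex.obj₀Equiv.symm 0)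

/-- `F(S¹)`: Milnor's construction on the simplicial circle. -/
def FS1 : SimplicialObject GrpCat.{0} := milnorF simplicialCircle simplicialCircle.pt

namespace FS1

/-- The generator of `F(S¹)_m` given by the simplex of `Δ[1]` that takes `i` times the value `0`
and `m + 1 - i` times the value `1`. It is `1` for `i = 0` and for `i = m + 1`, and `F(S¹)_m` is
free on the others. -/
def x {m : ℕ} (i : Fin (m + 2)) : FS1 _⦋m⦌ :=
  QuotientGroup.mk (FreeGroup.of (Quot.mk _ (SSet.stdSimplex.objMk₁ i)))

lemma objMk₁_mem_boundary {m : ℕ} (i : Fin (m + 2)) :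
    SSet.stdSimplex.objMk₁ i ∈ (SSet.boundary.{0} 1).obj (op ⦋m⦌) ↔ i = 0 ∨ i = Fin.last _ := by
  rw [SSet.mem_boundary_iff_notMem_range]
  constructor
  · rintro ⟨j, hj⟩
    by_contra! h
    apply hj
    have h0 : (i : ℕ) ≠ 0 := fun h' => h.1 (Fin.ext h')
    have h1 : (i : ℕ) ≠ m + 1 := fun h' => h.2 (Fin.ext h')
    fin_cases j
    · exact ⟨0, SSet.stdSimplex.objMk₁_of_castSucc_lt _ _ (by
        rw [Fin.lt_def, Fin.val_castSucc, Fin.val_zero]; omega)⟩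
    · exact ⟨Fin.last _, SSet.stdSimplex.objMk₁_of_le_castSucc _ _ (by simp [Fin.le_def]; omega)⟩
  · rintro (rfl | rfl)
    · refine ⟨0, ?_⟩
      rintro ⟨k, hk⟩
      simp [SSet.stdSimplex.objMk₁_apply_eq_zero_iff] at hk
    · refine ⟨1, ?_⟩
      rintro ⟨k, hk⟩
      rw [SSet.stdSimplex.objMk₁_apply_eq_one_iff] at hk
      simp [Fin.le_def] at hk
      omega

lemma x_eq_one {m : ℕ} (i : Fin (m + 2)) (h : i = 0 ∨ i = Fin.last _) : x i = 1 := by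
  refine (QuotientGroup.eq_one_iff _).2 (Subgroup.subset_normalClosure ?_)
  refine congrArg FreeGroup.of (Quot.sound ⟨(objMk₁_mem_boundary i).2 h, ?_⟩)
  refine (SSet.boundary.{0} 1).map _ ?_
  rw [SSet.boundary_obj_eq_univ 0 1]
  trivial

lemma δ_x {m : ℕ} (j : Fin (m + 2)) (i : Fin (m + 3)) : FS1.δ j (x i) = x (j.predAbove i) := by
  refine congrArg (fun t => QuotientGroup.mk (FreeGroup.of (Quot.mk _ t))) ?_
  rcases le_or_gt i j.castSucc with h | h
  · rw [Fin.predAbove_of_le_castSucc _ _ h]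
    exact SSet.stdSimplex.δ_objMk₁_of_le i j h
  · rw [Fin.predAbove_of_castSucc_lt _ _ h]
    exact SSet.stdSimplex.δ_objMk₁_of_lt i j h

/-- The index of a simplex of `Δ[1]`, inverse to `SSet.stdSimplex.objMk₁`. -/
noncomputable def index {m : ℕ} : (Δ[1] : SSet.{0}) _⦋m⦌ ≃ Fin (m + 2) :=
  (Equiv.ofBijective _ SSet.stdSimplex.objMk₁_bijective).symm

lemma objMk₁_index {m : ℕ} (a : (Δ[1] : SSet.{0}) _⦋m⦌) :
    SSet.stdSimplex.objMk₁ (index a) = a :=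
  (Equiv.ofBijective _ SSet.stdSimplex.objMk₁_bijective).apply_symm_apply a

lemma index_objMk₁ {m : ℕ} (i : Fin (m + 2)) :
    index (SSet.stdSimplex.objMk₁ i) = i :=
  (Equiv.ofBijective _ SSet.stdSimplex.objMk₁_bijective).symm_apply_apply i

lemma eq_one_of_mem_boundary {m : ℕ} {H : Type} [Group H] (f : Fin (m + 2) → H) (h0 : f 0 = 1)
    (h1 : f (Fin.last _) = 1) (a : (Δ[1] : SSet.{0}) _⦋m⦌)
    (ha : a ∈ (SSet.boundary.{0} 1).obj (op ⦋m⦌)) : f (index a) = 1 := by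
  rw [← objMk₁_index a, objMk₁_mem_boundary] at ha
  rcases ha with h | h <;> rw [h] <;> assumption

/-- The homomorphism out of `F(S¹)_m` with prescribed values on the generators `x i`. -/
noncomputable def lift {m : ℕ} {H : Type} [Group H] (f : Fin (m + 2) → H) (h0 : f 0 = 1)
    (h1 : f (Fin.last _) = 1) : FS1 _⦋m⦌ →* H :=
  QuotientGroup.lift _
    (FreeGroup.lift (Quot.lift (fun a => f (index a)) fun a b h =>
      (eq_one_of_mem_boundary f h0 h1 a h.1).trans (eq_one_of_mem_boundary f h0 h1 b h.2).symm))
    (by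
      refine Subgroup.normalClosure_le_normal (N := MonoidHom.ker _) ?_
      rintro _ rfl
      refine (FreeGroup.lift_apply_of ..).trans ?_
      refine eq_one_of_mem_boundary f h0 h1 _ ((SSet.boundary.{0} 1).map _ ?_)
      rw [SSet.boundary_obj_eq_univ 0 1]
      trivial)

@[simp]
lemma lift_x {m : ℕ} {H : Type} [Group H] (f : Fin (m + 2) → H) (h0 h1) (i : Fin (m + 2)) :
    lift f h0 h1 (x i) = f i := by
  refine (FreeGroup.lift_apply_of ..).trans ?_
  exact congrArg f (index_objMk₁ i)

lemma hom_ext {m : ℕ} {H : Type} [Group H] {f g : FS1 _⦋m⦌ →* H} (h : ∀ i, f (x i) = g (x i)) :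
    f = g := by
  refine QuotientGroup.monoidHom_ext _ (FreeGroup.ext_hom _ _ ?_)
  rintro ⟨a⟩
  have := h (index a)
  rw [x, objMk₁_index] at this
  exact this

/-- The generators `y` of `F(S¹)_m`, where `y k` stands for the element `y_{k-1}` of the usual
numbering `y_{-1}, y_0, …, y_{m-1}`: the elements `y_0, …, y_{m-1}` form a basis, and
`y_{-1} = (y_0 ⋯ y_{m-1})⁻¹`. -/
def y {m : ℕ} (k : Fin (m + 1)) : FS1 _⦋m⦌ := x k.castSucc * (x k.succ)⁻¹

lemma prod_y (m : ℕ) : (List.ofFn (y (m := m))).prod = 1 := by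
  have key : ∀ l (hl : l ≤ m + 1), (List.ofFn fun i : Fin l => y (m := m) ⟨i, by omega⟩).prod =
      (x ⟨l, by omega⟩)⁻¹ := by
    intro l
    induction l with
    | zero => intro _; simpa using x_eq_one _ (.inl rfl)
    | succ l ih =>
      intro hl
      rw [List.ofFn_succ', List.concat_eq_append, List.prod_append]
      have := ih (by omega)
      simp only [Fin.val_castSucc, Fin.val_last, List.prod_singleton]
      rw [this, y]
      exact inv_mul_cancel_left _ _
  refine (key (m + 1) le_rfl).trans ?_
  rw [x_eq_one ⟨m + 1, _⟩ (.inr rfl), inv_one]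

/-- The values of `σ_{k-1}` on the generators `x`; see `sigma_y_self`, `sigma_y_succ`,
`sigma_y_of_ne` for those on the `y`. -/
def sigmaFun {m : ℕ} (k : Fin m) (i : Fin (m + 2)) : FS1 _⦋m⦌ :=
  if i = k.succ.castSucc then
    x k.succ.succ * (x k.succ.castSucc)⁻¹ * x k.castSucc.castSucc
  else x i

/-- The values of the inverse of `σ_{k-1}` on the generators `x`. -/
def sigmaInvFun {m : ℕ} (k : Fin m) (i : Fin (m + 2)) : FS1 _⦋m⦌ :=
  if i = k.succ.castSucc then
    x k.castSucc.castSucc * (x k.succ.castSucc)⁻¹ * x k.succ.succ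
  else x i

/-- The endomorphism `σ_{k-1}`. -/
noncomputable def sigmaHom {m : ℕ} (k : Fin m) : FS1 _⦋m⦌ →* FS1 _⦋m⦌ :=
  lift (sigmaFun k)
    (by rw [sigmaFun, if_neg (by simp [Fin.ext_iff]), x_eq_one _ (.inl rfl)])
    (by rw [sigmaFun, if_neg (by simp [Fin.ext_iff]; omega), x_eq_one _ (.inr rfl)])

/-- The inverse of `σ_{k-1}`. -/
noncomputable def sigmaInvHom {m : ℕ} (k : Fin m) : FS1 _⦋m⦌ →* FS1 _⦋m⦌ :=
  lift (sigmaInvFun k)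
    (by rw [sigmaInvFun, if_neg (by simp [Fin.ext_iff]), x_eq_one _ (.inl rfl)])
    (by rw [sigmaInvFun, if_neg (by simp [Fin.ext_iff]; omega), x_eq_one _ (.inr rfl)])

lemma sigmaHom_x_self {m : ℕ} (k : Fin m) : sigmaHom k (x k.succ.castSucc) =
    x k.succ.succ * (x k.succ.castSucc)⁻¹ * x k.castSucc.castSucc := by
  rw [sigmaHom, lift_x, sigmaFun, if_pos rfl]

lemma sigmaHom_x_of_ne {m : ℕ} (k : Fin m) (i : Fin (m + 2)) (h : (i : ℕ) ≠ k + 1) :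
    sigmaHom k (x i) = x i := by
  rw [sigmaHom, lift_x, sigmaFun, if_neg (by simpa [Fin.ext_iff] using h)]

lemma sigmaInvHom_x_self {m : ℕ} (k : Fin m) : sigmaInvHom k (x k.succ.castSucc) =
    x k.castSucc.castSucc * (x k.succ.castSucc)⁻¹ * x k.succ.succ := by
  rw [sigmaInvHom, lift_x, sigmaInvFun, if_pos rfl]

lemma sigmaInvHom_x_of_ne {m : ℕ} (k : Fin m) (i : Fin (m + 2)) (h : (i : ℕ) ≠ k + 1) :
    sigmaInvHom k (x i) = x i := by
  rw [sigmaInvHom, lift_x, sigmaInvFun, if_neg (by simpa [Fin.ext_iff] using h)]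

lemma sigmaHom_comp_inv {m : ℕ} (k : Fin m) :
    (sigmaHom k).comp (sigmaInvHom k) = MonoidHom.id _ := by
  refine hom_ext fun i => ?_
  by_cases h : (i : ℕ) = k + 1
  · obtain rfl : i = k.succ.castSucc := Fin.ext (by simpa using h)
    simp only [MonoidHom.comp_apply, MonoidHom.id_apply, sigmaInvHom_x_self, map_mul, map_inv,
      sigmaHom_x_self, sigmaHom_x_of_ne k k.castSucc.castSucc (by simp),
      sigmaHom_x_of_ne k k.succ.succ (by simp)]
    group
  · simp [sigmaInvHom_x_of_ne k i h, sigmaHom_x_of_ne k i h]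

lemma sigmaInv_comp_sigmaHom {m : ℕ} (k : Fin m) :
    (sigmaInvHom k).comp (sigmaHom k) = MonoidHom.id _ := by
  refine hom_ext fun i => ?_
  by_cases h : (i : ℕ) = k + 1
  · obtain rfl : i = k.succ.castSucc := Fin.ext (by simpa using h)
    simp only [MonoidHom.comp_apply, MonoidHom.id_apply, sigmaInvHom_x_self, map_mul, map_inv,
      sigmaHom_x_self, sigmaInvHom_x_of_ne k k.castSucc.castSucc (by simp),
      sigmaInvHom_x_of_ne k k.succ.succ (by simp)]
    group
  · simp [sigmaInvHom_x_of_ne k i h, sigmaHom_x_of_ne k i h]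

/-- The automorphism `σ_{k-1}` of `F(S¹)_m`, for `0 ≤ k < m`. It is characterized by the lemmas
`sigma_y_self`, `sigma_y_succ` and `sigma_y_of_ne` below. -/
noncomputable def sigma {m : ℕ} (k : Fin m) : MulAut (FS1 _⦋m⦌) :=
  MonoidHom.toMulEquiv (sigmaHom k) (sigmaInvHom k) (sigmaInv_comp_sigmaHom k)
    (sigmaHom_comp_inv k)

lemma sigma_x_self {m : ℕ} (k : Fin m) : sigma k (x k.succ.castSucc) =
    x k.succ.succ * (x k.succ.castSucc)⁻¹ * x k.castSucc.castSucc :=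
  sigmaHom_x_self k

lemma sigma_x_of_ne {m : ℕ} (k : Fin m) (i : Fin (m + 2)) (h : (i : ℕ) ≠ k + 1) :
    sigma k (x i) = x i :=
  sigmaHom_x_of_ne k i h

lemma sigma_y_self {m : ℕ} (k : Fin m) : sigma k (y k.castSucc) = y k.succ := by
  have h : k.castSucc.succ = k.succ.castSucc := rfl
  rw [y, y, map_mul, map_inv, h, sigma_x_self, sigma_x_of_ne _ _ (by simp)]
  group

lemma sigma_y_succ {m : ℕ} (k : Fin m) :
    sigma k (y k.succ) = (y k.succ)⁻¹ * y k.castSucc * y k.succ := by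
  have h : k.castSucc.succ = k.succ.castSucc := rfl
  rw [y, y, map_mul, map_inv, h, sigma_x_self, sigma_x_of_ne _ _ (by simp)]
  group

lemma sigma_y_of_ne {m : ℕ} (k : Fin m) (j : Fin (m + 1)) (h : j ≠ k.castSucc)
    (h' : j ≠ k.succ) : sigma k (y j) = y j := by
  rw [Ne, Fin.ext_iff] at h h'
  simp only [Fin.val_castSucc, Fin.val_succ] at h h'
  rw [y, map_mul, map_inv, sigma_x_of_ne _ _ (by simpa using h'),
    sigma_x_of_ne _ _ (by simpa using h)]

/-- `x` with indices in `ℕ`. -/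
def xN (m i : ℕ) : FS1 _⦋m⦌ := if h : i < m + 2 then x ⟨i, h⟩ else 1

lemma x_eq_xN {m : ℕ} (i : Fin (m + 2)) : x i = xN m i := by simp [xN]

lemma sigma_xN {m : ℕ} (k : Fin m) (i : ℕ) : sigma k (xN m i) =
    if i = k + 1 then xN m (k + 2) * (xN m (k + 1))⁻¹ * xN m k else xN m i := by
  split_ifs with h
  · subst h
    have := sigma_x_self k
    simp only [x_eq_xN] at this
    exact this
  · by_cases hi : i < m + 2
    · simpa only [x_eq_xN] using sigma_x_of_ne k ⟨i, hi⟩ h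
    · simp [xN, hi]

lemma δ_xN {m : ℕ} (j : Fin (m + 2)) (i : ℕ) :
    FS1.δ j (xN (m + 1) i) = if i ≤ j then xN m i else xN m (i - 1) := by
  by_cases hi : i < m + 3
  · have := δ_x j ⟨i, hi⟩
    rw [x_eq_xN, x_eq_xN] at this
    rw [this]
    split_ifs with h
    · rw [Fin.predAbove_of_le_castSucc _ _ (by simpa [Fin.le_def] using h)]; rfl
    · rw [Fin.predAbove_of_castSucc_lt _ _ (by simpa [Fin.lt_def] using h)]; rfl
  · have h1 : ¬ i < m + 1 + 2 := by omega
    have h2 : ¬ i ≤ j := by omega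
    have h3 : ¬ i - 1 < m + 2 := by omega
    simp [xN, h1, h2, h3]

lemma aut_ext {m : ℕ} {f g : MulAut (FS1 _⦋m⦌)} (h : ∀ i, f (xN m i) = g (xN m i)) : f = g := by
  refine MulEquiv.toMonoidHom_injective (hom_ext fun i => ?_)
  rw [x_eq_xN]
  exact h i

/-- The action of the braid group `B_{m+1}` on `F(S¹)_m`; the generator with index `k` acts as
`σ_{k-1}`. -/
noncomputable def braidAut (m : ℕ) : BraidGroup (m + 1) →* MulAut (FS1 _⦋m⦌) :=
  BraidGroup.lift (fun k => sigma k)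
    (by
      intro i j h
      refine aut_ext fun l => ?_
      simp only [MulAut.mul_apply]
      have h1 : (i : ℕ) ≠ i + 2 := by omega
      rcases eq_or_ne l (i + 1) with hl | hl
      · subst hl
        simp [sigma_xN, ← h, h1]
      · rcases eq_or_ne l (i + 2) with hl' | hl'
        · subst hl'
          simp [sigma_xN, ← h, h1]
          group
        · simp [sigma_xN, ← h, hl, hl'])
    (by
      intro i j h
      refine aut_ext fun l => ?_
      simp only [MulAut.mul_apply]
      have h1 : (i : ℕ) ≠ j := by omega
      have h2 : (i : ℕ) + 1 ≠ j := by omega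
      have h3 : (i : ℕ) ≠ j + 1 := by omega
      have h4 : (j : ℕ) ≠ i + 1 := by omega
      have h5 : (j : ℕ) + 1 ≠ i := by omega
      rcases eq_or_ne l (i + 1) with hl | hl
      · subst hl
        simp [sigma_xN, h1, h2, h3]
      · rcases eq_or_ne l (j + 1) with hl' | hl'
        · subst hl'
          simp [sigma_xN, h1.symm, h4, h5]
        · simp [sigma_xN, hl, hl'])

lemma δ_sigma_lt {m : ℕ} (k : Fin m) (j : Fin (m + 2)) (h : (j : ℕ) ≤ k) (u : FS1 _⦋m + 1⦌) :
    FS1.δ j (sigma k.succ u) = sigma k (FS1.δ j u) := by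
  have : (FS1.δ j).hom.comp (sigma k.succ).toMonoidHom =
      (sigma k).toMonoidHom.comp (FS1.δ j).hom := by
    refine hom_ext fun i => ?_
    simp only [MonoidHom.comp_apply, MulEquiv.coe_toMonoidHom, x_eq_xN, sigma_xN, δ_xN]
    obtain ⟨i, hi⟩ := i
    by_cases h1 : i = (k + 1) + 1
    · subst h1
      simp only [Fin.val_succ, if_true, map_mul, map_inv, δ_xN]
      repeat' split
      all_goals first | omega | simp_all [sigma_xN]
    · simp only [Fin.val_succ, h1, if_false, δ_xN]
      repeat' split
      all_goals simp only [sigma_xN]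
      all_goals try split
      all_goals first | rfl | omega
  exact DFunLike.congr_fun this u

lemma δ_sigma_self {m : ℕ} (k : Fin (m + 1)) (u : FS1 _⦋m + 1⦌) :
    FS1.δ k.castSucc (sigma k u) = FS1.δ k.succ u := by
  have : (FS1.δ k.castSucc).hom.comp (sigma k).toMonoidHom = (FS1.δ k.succ).hom := by
    refine hom_ext fun i => ?_
    simp only [MonoidHom.comp_apply, MulEquiv.coe_toMonoidHom, x_eq_xN, sigma_xN, δ_xN]
    obtain ⟨i, hi⟩ := i
    by_cases h1 : i = k + 1
    · subst h1
      simp only [if_true, map_mul, map_inv, δ_xN, Fin.val_castSucc, Fin.val_succ]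
      repeat' split
      all_goals first | omega | simp_all
    · simp only [h1, if_false, δ_xN, Fin.val_castSucc, Fin.val_succ]
      repeat' split
      all_goals first | rfl | omega
  exact DFunLike.congr_fun this u

lemma δ_sigma_succ {m : ℕ} (k : Fin (m + 1)) (u : FS1 _⦋m + 1⦌) :
    FS1.δ k.succ (sigma k u) = FS1.δ k.castSucc u := by
  have : (FS1.δ k.succ).hom.comp (sigma k).toMonoidHom = (FS1.δ k.castSucc).hom := by
    refine hom_ext fun i => ?_
    simp only [MonoidHom.comp_apply, MulEquiv.coe_toMonoidHom, x_eq_xN, sigma_xN, δ_xN]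
    obtain ⟨i, hi⟩ := i
    by_cases h1 : i = k + 1
    · subst h1
      simp only [if_true, map_mul, map_inv, δ_xN, Fin.val_castSucc, Fin.val_succ]
      repeat' split
      all_goals first | omega | simp_all
    · simp only [h1, if_false, δ_xN, Fin.val_castSucc, Fin.val_succ]
      repeat' split
      all_goals first | rfl | omega
  exact DFunLike.congr_fun this u

lemma δ_sigma_gt {m : ℕ} (k : Fin m) (j : Fin (m + 2)) (h : (k : ℕ) + 1 < j)
    (u : FS1 _⦋m + 1⦌) :
    FS1.δ j (sigma k.castSucc u) = sigma k (FS1.δ j u) := by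
  have : (FS1.δ j).hom.comp (sigma k.castSucc).toMonoidHom =
      (sigma k).toMonoidHom.comp (FS1.δ j).hom := by
    refine hom_ext fun i => ?_
    simp only [MonoidHom.comp_apply, MulEquiv.coe_toMonoidHom, x_eq_xN, sigma_xN, δ_xN]
    obtain ⟨i, hi⟩ := i
    by_cases h1 : i = k + 1
    · subst h1
      simp only [Fin.val_castSucc, if_true, map_mul, map_inv, δ_xN]
      repeat' split
      all_goals first | omega | simp_all [sigma_xN]
    · simp only [Fin.val_castSucc, h1, if_false, δ_xN]
      repeat' split
      all_goals simp only [sigma_xN]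
      all_goals try split
      all_goals first | rfl | omega
  exact DFunLike.congr_fun this u

lemma sigma_mem_moore {m : ℕ} (k : Fin m) (u : FS1 _⦋m + 1⦌) :
    sigma k.succ u ∈ SimplicialGroup.moore FS1 (m + 1) ↔
      u ∈ SimplicialGroup.moore FS1 (m + 1) := by
  rw [SimplicialGroup.mem_moore_succ, SimplicialGroup.mem_moore_succ]
  have h1 : ∀ j : Fin (m + 1), (j : ℕ) < k →
      (FS1.δ j.succ (sigma k.succ u) = 1 ↔ FS1.δ j.succ u = 1) := by
    intro j hj
    rw [δ_sigma_lt k j.succ (by simpa using hj)]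
    exact map_eq_one_iff _ (sigma k).injective
  have h2 : ∀ j : Fin (m + 1), (k : ℕ) + 1 < j →
      (FS1.δ j.succ (sigma k.succ u) = 1 ↔ FS1.δ j.succ u = 1) := by
    intro j hj
    have hk : (k : ℕ) + 1 < m := by omega
    have := δ_sigma_gt ⟨k + 1, hk⟩ j.succ (by simpa using hj) u
    refine (Eq.congr_left this).trans ?_
    exact map_eq_one_iff _ (sigma _).injective
  have h3 := δ_sigma_self k.succ u
  have h4 := δ_sigma_succ k.succ u
  constructor <;> intro H j
  all_goals
    rcases lt_or_ge (j : ℕ) k with hj | hj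
    · first | (exact (h1 j hj).1 (H j)) | (exact (h1 j hj).2 (H j))
    rcases lt_or_ge ((k : ℕ) + 1) j with hj' | hj'
    · first | (exact (h2 j hj').1 (H j)) | (exact (h2 j hj').2 (H j))
    have : j = k.castSucc ∨ j = k.succ := by
      simp only [Fin.ext_iff, Fin.val_castSucc, Fin.val_succ]
      omega
    rcases this with rfl | rfl
  · exact h4.symm.trans (H k.succ)
  · exact h3.symm.trans (H k.castSucc)
  · exact h3.trans (H k.succ)
  · exact h4.trans (H k.castSucc)

lemma map_sigma_boundaries {m : ℕ} (k : Fin m) :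
    (SimplicialGroup.boundaries FS1 m).map (sigma k).toMonoidHom =
      SimplicialGroup.boundaries FS1 m := by
  ext v
  simp only [SimplicialGroup.boundaries, Subgroup.mem_map]
  constructor
  · rintro ⟨_, ⟨u, hu, rfl⟩, rfl⟩
    exact ⟨sigma k.succ u, (sigma_mem_moore k u).2 hu, δ_sigma_lt k 0 (by simp) u⟩
  · rintro ⟨u, hu, rfl⟩
    refine ⟨_, ⟨(sigma k.succ).symm u, (sigma_mem_moore k _).1 ?_, rfl⟩, ?_⟩
    · rwa [MulEquiv.apply_symm_apply]
    · refine (δ_sigma_lt k 0 (by simp) _).symm.trans ?_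
      rw [MulEquiv.apply_symm_apply]

lemma map_braidAut_boundaries {m : ℕ} (b : BraidGroup (m + 1)) :
    (SimplicialGroup.boundaries FS1 m).map (braidAut m b).toMonoidHom =
      SimplicialGroup.boundaries FS1 m := by
  let S : Subgroup (BraidGroup (m + 1)) :=
    { carrier := {b | (SimplicialGroup.boundaries FS1 m).map (braidAut m b).toMonoidHom =
        SimplicialGroup.boundaries FS1 m}
      one_mem' := by
        rw [Set.mem_ofPred_eq, map_one]
        exact Subgroup.map_id _
      mul_mem' := by
        intro b c hb hc
        rw [Set.mem_ofPred_eq] at hb hc ⊢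
        conv_rhs => rw [← hb, ← hc, Subgroup.map_map]
        rw [map_mul]
        rfl
      inv_mem' := by
        intro b hb
        rw [Set.mem_ofPred_eq] at hb ⊢
        conv_lhs => rw [← hb, Subgroup.map_map]
        have : ((braidAut m b⁻¹).toMonoidHom.comp (braidAut m b).toMonoidHom) =
            MonoidHom.id _ := by
          ext u
          simp
        rw [this, Subgroup.map_id] }
  refine PresentedGroup.generated_by _ S (fun k => ?_) b
  have h : braidAut m (PresentedGroup.of k) = sigma k := BraidGroup.lift_gen _ _ _ k
  change Subgroup.map (braidAut m (PresentedGroup.of k)).toMonoidHom _ = _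
  rw [h]
  exact map_sigma_boundaries (m := m) k

/-- The action of `B_{m+1}` on `F(S¹)_m / ℬ(F(S¹))_m` induced by its action on `F(S¹)_m`. -/
noncomputable instance (m : ℕ) :
    MulDistribMulAction (BraidGroup (m + 1)) (SimplicialGroup.modBoundaries FS1 m) where
  smul b := QuotientGroup.map _ _ (braidAut m b).toMonoidHom
    (Subgroup.map_le_iff_le_comap.1 (map_braidAut_boundaries b).le)
  one_smul := by
    rintro ⟨u⟩
    refine congrArg QuotientGroup.mk ?_
    simp
  mul_smul b c := by
    rintro ⟨u⟩
    refine congrArg QuotientGroup.mk ?_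
    simp
  smul_mul b u v := map_mul _ u v
  smul_one b := map_one _

lemma smul_mk {m : ℕ} (b : BraidGroup (m + 1)) (u : FS1 _⦋m⦌) :
    b • (QuotientGroup.mk u : SimplicialGroup.modBoundaries FS1 m) =
      QuotientGroup.mk (braidAut m b u) :=
  rfl

end FS1

end

/-!
The braid group acts on `π_{n+1}(F(S¹))` through the sign of the underlying permutation: for a cycle
`z`, the faces of the braided degeneracy `σ_k (s_k z)` are `σ_k z`, `z` and trivial ones, so
`σ_k z * z` bounds. Hence pure braids fix `π_{n+1}(F(S¹))`.

Conversely, the full twist of all the strands but the first is a pure braid acting on `F(S¹)_m` as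
conjugation by `y_{-1}`, whose centralizer in this free group is `⟨y_{-1}⟩`. As the boundaries are
cycles, the faces `d_j u` do not change when `u` is multiplied by a boundary; so for `u` fixed
modulo boundaries by the pure braids leaving out the first strand, the faces `d_j u` with `j > 0`
are powers of `y_{-1}`, and the simplicial identities make them the same power. The face `d_0 u` is
fixed by all pure braids, so it is a power of `y_{-1}` and, after braiding, of `y_0`; thus it is
trivial. As `d_0 y_{-1} = 1` and `d_j y_{-1} = y_{-1}` for `j > 0`, some `y_{-1}^{-k} u` is a cycle.
-/

lemma isCyclic_of_isFreeGroup {G : Type*} [Group G] [IsFreeGroup G] [IsMulCommutative G] :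
    IsCyclic G := by
  obtain ⟨ι, ⟨b⟩⟩ := IsFreeGroup.nonempty_basis (G := G)
  have : Subsingleton ι := by
    classical
    refine ⟨fun i j => by_contra fun hij => ?_⟩
    let f : G →* Equiv.Perm (Fin 3) :=
      b.lift fun k => if k = i then Equiv.swap 0 1 else Equiv.swap 1 2
    have hi : f (b i) = Equiv.swap 0 1 := by simp [f]
    have hj : f (b j) = Equiv.swap 1 2 := by simp [f, Ne.symm hij]
    have hcomm : f (b i) * f (b j) = f (b j) * f (b i) := by
      rw [← map_mul, mul_comm', map_mul]
    rw [hi, hj] at hcomm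
    exact absurd hcomm (by decide)
  have : IsCyclic (FreeGroup ι) := by
    rcases isEmpty_or_nonempty ι with h | ⟨⟨i⟩⟩
    · infer_instance
    · have : Unique ι := uniqueOfSubsingleton i
      infer_instance
  exact isCyclic_of_surjective b.repr.symm b.repr.symm.surjective

lemma mem_zpowers_of_commute_of_map_eq_ofAdd_one {G : Type*} [Group G] [IsFreeGroup G]
    (φ : G →* Multiplicative ℤ) {a v : G} (ha : φ a = Multiplicative.ofAdd 1)
    (h : Commute a v) : v ∈ Subgroup.zpowers a := by
  have : IsMulCommutative (Subgroup.closure {a, v}) := Subgroup.isMulCommutative_closure (by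
    rintro x (rfl | rfl) y (rfl | rfl)
    exacts [rfl, h, h.symm, rfl])
  obtain ⟨t, k, l, hk, hl⟩ : ∃ (t : G) (k l : ℤ), t ^ k = a ∧ t ^ l = v := by
    obtain ⟨t, ht⟩ :=
      (isCyclic_of_isFreeGroup (G := Subgroup.closure {a, v})).exists_zpow_surjective
    obtain ⟨k, hk⟩ := ht ⟨a, Subgroup.subset_closure (by simp)⟩
    obtain ⟨l, hl⟩ := ht ⟨v, Subgroup.subset_closure (by simp)⟩
    exact ⟨t, k, l, congrArg Subtype.val hk, congrArg Subtype.val hl⟩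
  have hunit : k * Multiplicative.toAdd (φ t) = 1 := by
    rw [← hk, map_zpow] at ha
    exact congrArg Multiplicative.toAdd ha
  rw [← hl, ← hk]
  rcases Int.isUnit_iff.1 (IsUnit.of_mul_eq_one _ hunit) with rfl | rfl
  · exact ⟨l, by simp⟩
  · exact ⟨-l, by simp⟩

lemma smul_mem_fixedPoints_of_mem_normalizer {G α : Type*} [Group G] [MulAction G α]
    {K : Subgroup G} {c : G} (hc : c ∈ Subgroup.normalizer (K : Set G)) {a : α}
    (ha : a ∈ MulAction.fixedPoints K α) : c • a ∈ MulAction.fixedPoints K α := by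
  rintro ⟨g, hg⟩
  have := ha ⟨c⁻¹ * g * c, (Subgroup.mem_normalizer_iff''.1 hc g).1 hg⟩
  rwa [Subgroup.mk_smul, mul_smul, mul_smul, inv_smul_eq_iff] at this

lemma map_smul_mem_fixedPoints_map {G H α : Type*} [Group G] [Group H] [MulAction H α]
    (f : G →* H) {N : Subgroup G} [N.Normal] {a : α}
    (ha : a ∈ MulAction.fixedPoints (N.map f) α) (c : G) :
    f c • a ∈ MulAction.fixedPoints (N.map f) α :=
  smul_mem_fixedPoints_of_mem_normalizer
    (Subgroup.le_normalizer_map f ⟨c, by simp [Subgroup.normalizer_eq_top N], rfl⟩) ha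

lemma finRotate_pow_self : ∀ n : ℕ, finRotate n ^ n = 1
  | 0 => pow_zero _
  | 1 => Subsingleton.elim _ _
  | n + 2 => by
    have h : orderOf (finRotate (n + 2)) = n + 2 := by
      rw [isCycle_finRotate.orderOf, support_finRotate, Finset.card_univ, Fintype.card_fin]
    exact orderOf_dvd_iff_pow_eq_one.1 h.dvd

namespace BraidGroup

instance (m : ℕ) : (pure m).Normal := MonoidHom.normal_ker _

@[elab_as_elim]
lemma induction_gen {m : ℕ} {p : BraidGroup m → Prop} (b : BraidGroup m) (one : p 1)
    (gen : ∀ i, p (gen i)) (mul : ∀ a b, p a → p b → p (a * b)) (inv : ∀ a, p a → p a⁻¹) : p b :=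
  PresentedGroup.generated_by _
    { carrier := {b | p b}, one_mem' := one, mul_mem' := mul _ _, inv_mem' := inv _ } gen b

lemma hom_ext {m : ℕ} {H : Type*} [Group H] {f g : BraidGroup m →* H}
    (h : ∀ i, f (gen i) = g (gen i)) : f = g :=
  PresentedGroup.ext h

lemma toPerm_gen {m : ℕ} (k : Fin m) :
    toPerm (m + 1) (gen k) = Equiv.swap k.castSucc k.succ :=
  lift_gen (m := m + 1) _ _ _ k

lemma shift_gen {m : ℕ} (k : Fin m) :
    shift (m + 1) (gen k) = gen (m := m + 1 + 1) k.succ :=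
  lift_gen (m := m + 1) _ _ _ k

lemma toPerm_shift {m : ℕ} (b : BraidGroup (m + 1)) :
    toPerm (m + 1 + 1) (shift (m + 1) b) =
      Equiv.Perm.viaEmbeddingHom (Fin.succEmb (m + 1)) (toPerm (m + 1) b) := by
  refine DFunLike.congr_fun (f := (toPerm (m + 1 + 1)).comp (shift (m + 1)))
    (g := (Equiv.Perm.viaEmbeddingHom (Fin.succEmb (m + 1))).comp (toPerm (m + 1)))
    (hom_ext fun (k : Fin m) => Equiv.ext fun i => ?_) b
  rw [MonoidHom.comp_apply, MonoidHom.comp_apply, shift_gen, toPerm_gen, toPerm_gen,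
    Equiv.Perm.viaEmbeddingHom_apply]
  cases i using Fin.cases with
  | zero =>
    rw [Equiv.Perm.viaEmbedding_apply_of_notMem _ _ _ (by simp),
      Equiv.swap_apply_of_ne_of_ne (by simp [Fin.ext_iff]) (by simp [Fin.ext_iff])]
  | succ i =>
    refine Eq.trans ?_ (Equiv.Perm.viaEmbedding_apply _ (Fin.succEmb (m + 1)) i).symm
    exact (Fin.succ_injective _).swap_apply k.castSucc k.succ i

lemma shift_mem_pure {m : ℕ} {b : BraidGroup (m + 1)} (hb : b ∈ pure (m + 1)) :
    shift (m + 1) b ∈ pure (m + 1 + 1) :=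
  MonoidHom.mem_ker.2 (by rw [toPerm_shift, MonoidHom.mem_ker.1 hb, map_one])

/-- The product `σ₀ ⋯ σ_{l-1}` of the first `l` generators; it lifts the permutation
`Fin.cycleRange l`. -/
def cycleRange {m : ℕ} (l : Fin (m + 1)) : BraidGroup (m + 1) :=
  Fin.partialProd (gen (m := m + 1)) l

lemma cycleRange_zero (m : ℕ) : cycleRange (0 : Fin (m + 1)) = 1 :=
  Fin.partialProd_zero _

lemma cycleRange_succ {m : ℕ} (l : Fin m) :
    cycleRange l.succ = cycleRange l.castSucc * gen (m := m + 1) l :=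
  Fin.partialProd_succ (gen (m := m + 1)) l

lemma toPerm_cycleRange {m : ℕ} (l : Fin (m + 1)) :
    toPerm (m + 1) (cycleRange l) = l.cycleRange := by
  induction l using Fin.induction with
  | zero => rw [cycleRange_zero, map_one, Fin.cycleRange_zero]
  | succ l ih =>
    rw [cycleRange_succ, map_mul, ih, toPerm_gen]
    refine Equiv.ext fun i => ?_
    rcases lt_trichotomy i l.castSucc with hi | rfl | hi
    · rw [Equiv.Perm.mul_apply,
        Equiv.swap_apply_of_ne_of_ne hi.ne (hi.trans l.castSucc_lt_succ).ne,
        Fin.cycleRange_of_lt hi, Fin.cycleRange_of_lt (hi.trans l.castSucc_lt_succ)]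
    · rw [Equiv.Perm.mul_apply, Equiv.swap_apply_left, Fin.cycleRange_of_gt l.castSucc_lt_succ,
        Fin.cycleRange_of_lt l.castSucc_lt_succ, Fin.coeSucc_eq_succ]
    rcases (Fin.castSucc_lt_iff_succ_le.1 hi).eq_or_lt with rfl | hgt
    · rw [Equiv.Perm.mul_apply, Equiv.swap_apply_right, Fin.cycleRange_self, Fin.cycleRange_self]
    · rw [Equiv.Perm.mul_apply, Equiv.swap_apply_of_ne_of_ne hi.ne' hgt.ne',
        Fin.cycleRange_of_gt hi, Fin.cycleRange_of_gt hgt]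

/-- The full twist `(σ₀ ⋯ σ_{m-1})^{m+1}` of all the strands; it is a pure braid. -/
def fullTwist (m : ℕ) : BraidGroup (m + 1) := cycleRange (Fin.last m) ^ (m + 1)

lemma fullTwist_mem_pure (m : ℕ) : fullTwist m ∈ pure (m + 1) := by
  rw [pure, MonoidHom.mem_ker, fullTwist, map_pow, toPerm_cycleRange,
    Fin.cycleRange_last, finRotate_pow_self]

end BraidGroup

section

open CategoryTheory Opposite Simplicial

/-! ### Boundaries in simplicial groups -/

namespace SimplicialGroup

variable (G : SimplicialObject GrpCat.{0}) {m : ℕ}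

lemma mem_cycles_succ (x : G.obj (op (.mk (m + 1)))) :
    x ∈ cycles G (m + 1) ↔ ∀ j : Fin (m + 2), G.δ j x = 1 := by
  simp [cycles, Subgroup.mem_iInf, MonoidHom.mem_ker]

lemma δ_δ_of_le {i j : Fin (m + 2)} (h : i ≤ j) (x : G.obj (op (.mk (m + 2)))) :
    G.δ i (G.δ j.succ x) = G.δ j (G.δ i.castSucc x) :=
  ConcreteCategory.congr_hom (G.δ_comp_δ h) x

lemma δ_σ_castSucc (i : Fin (m + 1)) (z : G.obj (op (.mk m))) :
    G.δ i.castSucc (G.σ i z) = z := by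
  simpa using ConcreteCategory.congr_hom (G.δ_comp_σ_self (i := i)) z

lemma δ_σ_succ (i : Fin (m + 1)) (z : G.obj (op (.mk m))) : G.δ i.succ (G.σ i z) = z := by
  simpa using ConcreteCategory.congr_hom (G.δ_comp_σ_succ (i := i)) z

lemma δ_σ_of_ne {i : Fin (m + 2)} {j : Fin (m + 3)} (h : j ≠ i.castSucc) (h' : j ≠ i.succ)
    {z : G.obj (op (.mk (m + 1)))} (hz : z ∈ cycles G (m + 1)) : G.δ j (G.σ i z) = 1 := by
  rw [mem_cycles_succ] at hz
  rcases lt_or_gt_of_ne h with hlt | hgt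
  · obtain ⟨i, rfl⟩ := Fin.exists_succ_eq.2 (Fin.castSucc_ne_zero_iff.1 (Fin.ne_zero_of_lt hlt))
    obtain ⟨j, rfl⟩ := Fin.exists_castSucc_eq.2 (Fin.ne_last_of_lt hlt)
    refine (ConcreteCategory.congr_hom (G.δ_comp_σ_of_le (i := j) (j := i) ?_) z).trans ?_
    · simpa [Fin.le_castSucc_iff] using hlt
    · simp [hz j]
  · have hgt' : i.succ < j := lt_of_le_of_ne (Fin.castSucc_lt_iff_succ_le.1 hgt) h'.symm
    obtain ⟨j, rfl⟩ := Fin.exists_succ_eq.2 (Fin.ne_zero_of_lt hgt)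
    obtain ⟨i, rfl⟩ := Fin.exists_castSucc_eq.2 (Fin.ne_last_of_lt (Fin.succ_lt_succ_iff.1 hgt'))
    refine (ConcreteCategory.congr_hom (G.δ_comp_σ_of_gt (i := j) (j := i) ?_) z).trans ?_
    · simpa using hgt'
    · simp [hz j]

lemma δ_mem_cycles {i : Fin (m + 3)} {w : G.obj (op (.mk (m + 2)))}
    (hw : ∀ j, j ≠ i → G.δ j w = 1) : G.δ i w ∈ cycles G (m + 1) := by
  rw [mem_cycles_succ]
  intro j
  rcases lt_or_ge j.castSucc i with hlt | hge
  · obtain ⟨i, rfl⟩ := Fin.exists_succ_eq.2 (Fin.ne_zero_of_lt hlt)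
    rw [δ_δ_of_le G (Fin.castSucc_lt_succ_iff.1 hlt), hw _ hlt.ne, map_one]
  · have hlt : i < j.succ := hge.trans_lt j.castSucc_lt_succ
    obtain ⟨i, rfl⟩ := Fin.exists_castSucc_eq.2 (Fin.ne_last_of_lt hlt)
    rw [← δ_δ_of_le G (Fin.castSucc_le_castSucc_iff.1 hge), hw _ hlt.ne', map_one]

lemma boundaries_le_cycles (m : ℕ) : boundaries G m ≤ cycles G m := by
  cases m with
  | zero => exact le_top
  | succ m =>
    rintro _ ⟨u, hu, rfl⟩
    refine δ_mem_cycles G fun j hj => ?_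
    obtain ⟨j, rfl⟩ := Fin.exists_succ_eq.2 hj
    exact (mem_moore_succ G u).1 hu j

lemma δ_mem_boundaries {i : Fin (m + 3)} {w : G.obj (op (.mk (m + 2)))}
    (hw : ∀ j, j ≠ i → G.δ j w = 1) : G.δ i w ∈ boundaries G (m + 1) := by
  induction i using Fin.induction generalizing w with
  | zero => exact ⟨w, (mem_moore_succ G w).2 fun j => hw _ j.succ_ne_zero, rfl⟩
  | succ i ih =>
    -- Multiplying by a degeneracy moves the only nontrivial face from `i + 1` to `i`.
    set b := G.δ i.succ w
    have hb : b⁻¹ ∈ cycles G (m + 1) := inv_mem (δ_mem_cycles G hw)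
    have hδ : G.δ i.castSucc (w * G.σ i b⁻¹) = b⁻¹ := by
      rw [map_mul, δ_σ_castSucc, hw _ i.castSucc_lt_succ.ne, one_mul]
    rw [← inv_mem_iff, ← hδ]
    refine ih fun j hj => ?_
    rw [map_mul]
    rcases eq_or_ne j i.succ with rfl | hj'
    · rw [δ_σ_succ, mul_inv_cancel]
    · rw [hw j hj', one_mul, δ_σ_of_ne G hj hj' hb]

lemma δ_mul_δ_mem_boundaries {i : Fin (m + 1)} {w : G.obj (op (.mk (m + 2)))}
    (hc : G.δ i.succ.succ w ∈ cycles G (m + 1))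
    (hw : ∀ j, j ≠ i.castSucc.castSucc → j ≠ i.succ.succ → G.δ j w = 1) :
    G.δ i.castSucc.castSucc w * G.δ i.succ.succ w ∈ boundaries G (m + 1) := by
  set a := G.δ i.castSucc.castSucc w
  set b := G.δ i.succ.succ w with hb
  have hlt : i.castSucc.castSucc < i.castSucc.succ := i.castSucc.castSucc_lt_succ
  have hlt' : i.castSucc.succ < i.succ.succ := i.succ.castSucc_lt_succ
  have hδ : G.δ i.castSucc.castSucc (w * G.σ i.succ b⁻¹ * G.σ i.castSucc b) = a * b := by
    rw [map_mul, map_mul, δ_σ_castSucc, δ_σ_of_ne G hlt.ne (hlt.trans hlt').ne (inv_mem hc),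
      mul_one]
  rw [← hδ]
  refine δ_mem_boundaries G fun j hj => ?_
  rw [map_mul, map_mul]
  rcases eq_or_ne j i.castSucc.succ with rfl | hj1
  · have hσ : G.δ i.castSucc.succ (G.σ i.succ b⁻¹) = b⁻¹ := δ_σ_castSucc G i.succ _
    rw [δ_σ_succ, hw _ hj hlt'.ne, hσ, one_mul, inv_mul_cancel]
  rw [δ_σ_of_ne G hj hj1 hc, mul_one]
  rcases eq_or_ne j i.succ.succ with rfl | hj2
  · rw [δ_σ_succ, ← hb, mul_inv_cancel]
  · rw [hw j hj hj2, δ_σ_of_ne G hj1 hj2 (inv_mem hc), one_mul]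

lemma homotopyIncl_injective (m : ℕ) : Function.Injective (homotopyIncl G m) := by
  rw [injective_iff_map_eq_one]
  rintro ⟨z⟩ hz
  exact (QuotientGroup.eq_one_iff _).2
    (Subgroup.mem_subgroupOf.2 ((QuotientGroup.eq_one_iff _).1 hz))

lemma mk_mem_range_homotopyIncl (u : G.obj (op (.mk m))) :
    (QuotientGroup.mk u : modBoundaries G m) ∈ (homotopyIncl G m).range ↔ u ∈ cycles G m := by
  constructor
  · rintro ⟨⟨z⟩, hz⟩
    have h : (z : G.obj (op (.mk m)))⁻¹ * u ∈ boundaries G m := QuotientGroup.eq.1 hz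
    simpa using mul_mem z.2 (boundaries_le_cycles G m h)
  · exact fun h => ⟨QuotientGroup.mk ⟨u, h⟩, rfl⟩

end SimplicialGroup

/-! ### The full twist on `F(S¹)_{m+1}` -/

namespace FS1

open SimplicialGroup

variable {m : ℕ}

/-- The basis `x₁, …, x_m` of `F(S¹)_m`, showing that this quotient of a free group is free. -/
noncomputable def basis (m : ℕ) : FreeGroupBasis (Fin m) (FS1 _⦋m⦌) where
  repr := MonoidHom.toMulEquiv
    (lift (fun i => if h : (i : ℕ) - 1 < m ∧ 0 < (i : ℕ) then FreeGroup.of ⟨i - 1, h.1⟩ else 1)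
      (by simp) (by simp))
    (FreeGroup.lift fun i => x i.succ.castSucc)
    (by
      refine hom_ext fun i => ?_
      rw [MonoidHom.comp_apply, lift_x, MonoidHom.id_apply]
      split_ifs with h
      · rw [FreeGroup.lift_apply_of]
        exact congrArg x (Fin.ext (Nat.sub_add_cancel h.2))
      · rw [map_one, x_eq_one]
        simp only [Fin.ext_iff, Fin.val_last, Fin.val_zero]
        omega)
    (by
      ext i
      simp)

instance (m : ℕ) : IsFreeGroup (FS1 _⦋m⦌) := (basis m).isFreeGroup

/-- The negative of the exponent sum of the basis element with index `k`. It is used to tell the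
powers of an element `y` apart; the sign makes `y k.castSucc` have degree `1`. -/
noncomputable def degree (k : Fin m) : FS1 _⦋m⦌ →* Multiplicative ℤ :=
  lift (fun i => if i = k.succ.castSucc then Multiplicative.ofAdd (-1) else 1)
    (if_neg (by simp [Fin.ext_iff])) (if_neg (Fin.castSucc_lt_last _).ne')

lemma degree_y_castSucc (k : Fin m) : degree k (y k.castSucc) = Multiplicative.ofAdd 1 := by
  rw [y, map_mul, map_inv, degree, lift_x, lift_x, if_neg (by simp [Fin.ext_iff]),
    if_pos k.succ_castSucc, one_mul, ofAdd_neg, inv_inv]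

lemma degree_y_of_lt {k : Fin m} {j : Fin (m + 1)} (h : j < k.castSucc) : degree k (y j) = 1 := by
  have hlt : j.castSucc < k.succ.castSucc := h.trans k.castSucc_lt_succ
  have hlt' : j.succ < k.succ.castSucc := Fin.succ_lt_succ_iff.2 h
  rw [y, map_mul, map_inv, degree, lift_x, lift_x, if_neg hlt.ne, if_neg hlt'.ne, inv_one, one_mul]

lemma y_zero : y (0 : Fin (m + 1)) = (x 1)⁻¹ := by
  rw [y, x_eq_one (Fin.castSucc 0) (.inl rfl), one_mul]
  rfl

lemma δ_zero_y_zero : FS1.δ 0 (y 0 : FS1 _⦋m + 1⦌) = 1 := by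
  rw [y_zero, map_inv, δ_x, x_eq_one _ (.inl (by simp)), inv_one]

lemma δ_succ_y_zero (j : Fin (m + 1)) : FS1.δ j.succ (y 0 : FS1 _⦋m + 1⦌) = y 0 := by
  rw [y_zero, map_inv, δ_x, y_zero]
  congr 2

lemma y_zero_zpow_injective : Function.Injective fun k : ℤ => (y 0 : FS1 _⦋m + 1⦌) ^ k := by
  intro k l h
  have := congrArg (degree 0) h
  simp only [map_zpow] at this
  rw [show degree 0 (y 0 : FS1 _⦋m + 1⦌) = _ from degree_y_castSucc 0] at this
  simpa [← ofAdd_zsmul] using this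

lemma mem_zpowers_y_zero_of_commute {v : FS1 _⦋m + 1⦌} (h : Commute (y 0) v) :
    v ∈ Subgroup.zpowers (y 0) :=
  mem_zpowers_of_commute_of_map_eq_ofAdd_one (degree 0) (degree_y_castSucc 0) h

lemma hom_ext_y {H : Type} [Group H] {f g : FS1 _⦋m⦌ →* H} (h : ∀ k, f (y k) = g (y k)) :
    f = g := by
  refine hom_ext fun i => ?_
  induction i using Fin.induction with
  | zero => rw [x_eq_one _ (.inl rfl), map_one, map_one]
  | succ k ih =>
    have := h k
    rwa [y, map_mul, map_mul, ih, mul_right_inj, map_inv, map_inv, inv_inj] at this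

lemma braidAut_gen (k : Fin m) : braidAut m (BraidGroup.gen k) = sigma k :=
  BraidGroup.lift_gen (m := m + 1) _ _ _ k

lemma braidAut_shift_gen (k : Fin m) :
    braidAut (m + 1) (BraidGroup.shift (m + 1) (BraidGroup.gen k)) = sigma k.succ := by
  rw [BraidGroup.shift_gen]
  exact braidAut_gen k.succ

lemma braidAut_shift_y_zero (b : BraidGroup (m + 1)) :
    braidAut (m + 1) (BraidGroup.shift (m + 1) b) (y 0) = y 0 := by
  induction b using BraidGroup.induction_gen with
  | one => simp
  | gen k =>
    refine (DFunLike.congr_fun (braidAut_shift_gen k) _).trans ?_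
    exact sigma_y_of_ne _ _ (Fin.castSucc_ne_zero_iff.2 k.succ_ne_zero).symm
      (Fin.succ_ne_zero _).symm
  | mul a b ha hb => rw [map_mul, map_mul, MulAut.mul_apply, hb, ha]
  | inv a ha => rw [map_inv, map_inv, MulAut.inv_apply, MulEquiv.symm_apply_eq, ha]

lemma braidAut_shift_cycleRange_succ (l : Fin m) (u : FS1 _⦋m + 1⦌) :
    braidAut (m + 1) (BraidGroup.shift (m + 1) (BraidGroup.cycleRange l.succ)) u =
      braidAut (m + 1) (BraidGroup.shift (m + 1) (BraidGroup.cycleRange l.castSucc))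
        (sigma l.succ u) := by
  rw [← braidAut_shift_gen, ← MulAut.mul_apply, ← map_mul, ← map_mul, BraidGroup.cycleRange_succ]

lemma braidAut_shift_cycleRange_y_of_lt {l : Fin (m + 1)} {j : Fin (m + 2)} (h : l.succ < j) :
    braidAut (m + 1) (BraidGroup.shift (m + 1) (BraidGroup.cycleRange l)) (y j) = y j := by
  induction l using Fin.induction with
  | zero => rw [BraidGroup.cycleRange_zero, map_one, map_one, MulAut.one_apply]
  | succ l ih =>
    have hlt : l.succ.castSucc < j := l.succ.castSucc_lt_succ.trans h
    rw [braidAut_shift_cycleRange_succ, sigma_y_of_ne _ _ hlt.ne' h.ne', ih hlt]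

lemma braidAut_shift_cycleRange_y_of_le {l : Fin (m + 1)} {k : Fin m} (h : k.succ ≤ l) :
    braidAut (m + 1) (BraidGroup.shift (m + 1) (BraidGroup.cycleRange l)) (y k.succ.castSucc) =
      y k.succ.succ := by
  induction l using Fin.induction with
  | zero => exact absurd h (Fin.succ_ne_zero k ∘ Fin.le_zero_iff.1)
  | succ l ih =>
    rw [braidAut_shift_cycleRange_succ]
    rcases (Fin.succ_le_succ_iff.1 h).eq_or_lt with rfl | hlt
    · exact (congrArg _ (sigma_y_self k.succ)).trans
        (braidAut_shift_cycleRange_y_of_lt k.succ.castSucc_lt_succ)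
    · have hlt' : k.succ.castSucc < l.succ.castSucc := by simpa using hlt
      rw [sigma_y_of_ne _ _ hlt'.ne (hlt'.trans l.succ.castSucc_lt_succ).ne,
        ih (Fin.castSucc_lt_iff_succ_le.1 (by simpa using hlt))]

/-- The action on `F(S¹)_{m+1}` of `σ₀ ⋯ σ_{m-1}` (in the numbering where `sigma k` is `σ_{k-1}`),
which rotates all the strands but the first. -/
noncomputable def rotationAut (m : ℕ) : MulAut (FS1 _⦋m + 1⦌) :=
  braidAut (m + 1) (BraidGroup.shift (m + 1) (BraidGroup.cycleRange (Fin.last m)))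

lemma rotationAut_y_zero : rotationAut m (y 0) = y 0 := braidAut_shift_y_zero _

lemma rotationAut_y_succ (k : Fin m) : rotationAut m (y k.castSucc.succ) = y k.succ.succ :=
  braidAut_shift_cycleRange_y_of_le (Fin.le_last _)

lemma rotationAut_y_last :
    rotationAut m (y (Fin.last (m + 1))) = MulAut.conj (y 0) (y 1) := by
  set t := (List.ofFn fun k : Fin m => y (m := m + 1) k.succ.succ).prod
  have hleft : y (m := m + 1) 0 * (y 1 * t) = 1 := by
    rw [← prod_y (m + 1), List.ofFn_succ, List.prod_cons, List.ofFn_succ, List.prod_cons]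
    rfl
  have hright : y 0 * (t * rotationAut m (y (Fin.last (m + 1)))) = 1 := by
    have := congrArg (rotationAut m) (prod_y (m + 1))
    rw [List.ofFn_succ, List.ofFn_succ', List.concat_eq_append, List.prod_cons, List.prod_append,
      map_mul, map_mul, map_list_prod, rotationAut_y_zero, List.map_ofFn, List.prod_singleton,
      map_one] at this
    rw [← this]
    congr 2
    exact congrArg (fun f => (List.ofFn f).prod) (funext fun k => (rotationAut_y_succ k).symm)
  rw [← mul_assoc] at hleft hright
  rw [MulAut.conj_apply, eq_inv_of_mul_eq_one_right hright, eq_inv_of_mul_eq_one_right hleft]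
  group

lemma rotationAut_pow_y_one (i : Fin (m + 1)) : (rotationAut m ^ (i : ℕ)) (y 1) = y i.succ := by
  induction i using Fin.induction with
  | zero => rfl
  | succ i ih =>
    rw [Fin.val_succ, pow_succ', MulAut.mul_apply]
    exact (congrArg _ ih).trans (rotationAut_y_succ i)

lemma braidAut_shift_fullTwist :
    braidAut (m + 1) (BraidGroup.shift (m + 1) (BraidGroup.fullTwist m)) = MulAut.conj (y 0) := by
  rw [BraidGroup.fullTwist, map_pow, map_pow]
  change rotationAut m ^ (m + 1) = _
  refine MulEquiv.toMonoidHom_injective (hom_ext_y fun k => ?_)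
  have hzero (l : ℕ) : (rotationAut m ^ l) (y 0) = y 0 := by
    rw [rotationAut, ← map_pow, ← map_pow, braidAut_shift_y_zero]
  have hone : (rotationAut m ^ (m + 1)) (y 1) = MulAut.conj (y 0) (y 1) := by
    rw [pow_succ', MulAut.mul_apply]
    exact (congrArg _ (rotationAut_pow_y_one (Fin.last m))).trans rotationAut_y_last
  cases k using Fin.cases with
  | zero => simpa using hzero (m + 1)
  | succ k =>
    change (rotationAut m ^ (m + 1)) (y k.succ) = MulAut.conj (y 0) (y k.succ)
    rw [← rotationAut_pow_y_one, ← MulAut.mul_apply, ← pow_add, Nat.add_comm (m + 1), pow_add,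
      MulAut.mul_apply, hone, MulAut.conj_apply, map_mul, map_mul, map_inv, hzero,
      MulAut.conj_apply]

lemma mem_zpowers_y_zero_of_braidAut_shift_fullTwist {v : FS1 _⦋m + 1⦌}
    (h : braidAut (m + 1) (BraidGroup.shift (m + 1) (BraidGroup.fullTwist m)) v = v) :
    v ∈ Subgroup.zpowers (y 0) := by
  rw [braidAut_shift_fullTwist, MulAut.conj_apply, mul_inv_eq_iff_eq_mul] at h
  exact mem_zpowers_y_zero_of_commute h

/-! ### The action on homotopy groups by signs -/

lemma δ_sigma_eq_one {k : Fin (m + 1)} {j : Fin (m + 2)} (h : j ≠ k.castSucc) (h' : j ≠ k.succ)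
    {u : FS1 _⦋m + 1⦌} (hu : FS1.δ j u = 1) : FS1.δ j (sigma k u) = 1 := by
  rcases lt_or_gt_of_ne h with hlt | hgt
  · obtain ⟨k, rfl⟩ := Fin.exists_succ_eq.2 (Fin.castSucc_ne_zero_iff.1 (Fin.ne_zero_of_lt hlt))
    rw [δ_sigma_lt k j (Nat.lt_succ_iff.1 hlt), hu, map_one]
  · have hgt' : k.succ < j := lt_of_le_of_ne (Fin.castSucc_lt_iff_succ_le.1 hgt) h'.symm
    obtain ⟨k, rfl⟩ := Fin.exists_castSucc_eq.2
      ((Fin.succ_ne_last_iff _).1 (Fin.ne_last_of_lt hgt'))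
    rw [δ_sigma_gt k j hgt', hu, map_one]

lemma sigma_mul_mem_boundaries (k : Fin (m + 1)) {z : FS1 _⦋m + 1⦌}
    (hz : z ∈ cycles FS1 (m + 1)) : sigma k z * z ∈ boundaries FS1 (m + 1) := by
  set w := sigma k.succ (FS1.σ k.castSucc z) with hw
  have hlow : FS1.δ k.castSucc.castSucc w = sigma k z := by
    rw [hw, δ_sigma_lt k k.castSucc.castSucc le_rfl, δ_σ_castSucc]
  have hhigh : FS1.δ k.succ.succ w = z :=
    (δ_sigma_succ k.succ _).trans (δ_σ_succ FS1 k.castSucc z)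
  suffices h : FS1.δ k.castSucc.castSucc w * FS1.δ k.succ.succ w ∈ boundaries FS1 (m + 1) by
    rwa [hlow, hhigh] at h
  refine δ_mul_δ_mem_boundaries FS1 (hhigh.symm ▸ hz) fun j hj hj' => ?_
  rcases eq_or_ne j k.succ.castSucc with rfl | h
  · rw [hw, δ_sigma_self]
    exact δ_σ_of_ne FS1 (Fin.castSucc_lt_succ.trans k.succ.castSucc_lt_succ).ne'
      k.succ.castSucc_lt_succ.ne' hz
  · exact δ_sigma_eq_one h hj' (δ_σ_of_ne FS1 hj h hz)

lemma gen_smul_of_mem_range (k : Fin (m + 1)) {q : modBoundaries FS1 (m + 1)}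
    (hq : q ∈ (homotopyIncl FS1 (m + 1)).range) :
    (BraidGroup.gen k : BraidGroup (m + 1 + 1)) • q = q⁻¹ := by
  obtain ⟨z, rfl⟩ := QuotientGroup.mk_surjective q
  rw [mk_mem_range_homotopyIncl] at hq
  rw [eq_inv_iff_mul_eq_one, smul_mk, braidAut_gen]
  exact (QuotientGroup.eq_one_iff _).2 (sigma_mul_mem_boundaries k hq)

lemma smul_of_mem_range (b : BraidGroup (m + 1 + 1)) {q : modBoundaries FS1 (m + 1)}
    (hq : q ∈ (homotopyIncl FS1 (m + 1)).range) :
    b • q = q ^ ((BraidGroup.toPerm (m + 1 + 1) b).sign : ℤ) := by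
  induction b using BraidGroup.induction_gen with
  | one => rw [one_smul, map_one, map_one, Units.val_one, zpow_one]
  | gen k =>
    have hsign : (BraidGroup.toPerm (m + 1 + 1) (BraidGroup.gen k)).sign = -1 := by
      rw [BraidGroup.toPerm_gen, Equiv.Perm.sign_swap Fin.castSucc_lt_succ.ne]
    rw [hsign, gen_smul_of_mem_range k hq, Units.val_neg, Units.val_one, zpow_neg_one]
  | mul a b ha hb =>
    rw [mul_smul, hb, smul_zpow', ha, ← zpow_mul, map_mul, map_mul, Units.val_mul]
  | inv a ha =>
    rw [inv_smul_eq_iff, smul_zpow', ha, ← zpow_mul, map_inv, map_inv, Units.mul_inv, zpow_one]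

lemma smul_eq_self_of_mem_pure {b : BraidGroup (m + 1 + 1)}
    (hb : b ∈ BraidGroup.pure (m + 1 + 1)) {q : modBoundaries FS1 (m + 1)}
    (hq : q ∈ (homotopyIncl FS1 (m + 1)).range) : b • q = q := by
  rw [smul_of_mem_range b hq, MonoidHom.mem_ker.1 hb, map_one, Units.val_one, zpow_one]

lemma δ_braidAut {k : ℕ} {j : Fin (m + 2)} {φ : BraidGroup k →* BraidGroup (m + 1 + 1)}
    {ψ : BraidGroup k →* BraidGroup (m + 1)}
    (h : ∀ i u, FS1.δ j (braidAut (m + 1) (φ (.gen i)) u) = braidAut m (ψ (.gen i)) (FS1.δ j u))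
    (b : BraidGroup k) (u : FS1 _⦋m + 1⦌) :
    FS1.δ j (braidAut (m + 1) (φ b) u) = braidAut m (ψ b) (FS1.δ j u) := by
  induction b using BraidGroup.induction_gen generalizing u with
  | one => simp only [map_one, MulAut.one_apply]
  | gen i => exact h i u
  | mul a b ha hb => simp only [map_mul, MulAut.mul_apply, ha, hb]
  | inv a ha =>
    rw [map_inv, map_inv, map_inv, map_inv, MulAut.inv_apply, MulAut.inv_apply,
      MulEquiv.eq_symm_apply, ← ha, MulEquiv.apply_symm_apply]

lemma δ_zero_braidAut_shift (b : BraidGroup (m + 1)) (u : FS1 _⦋m + 1⦌) :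
    FS1.δ 0 (braidAut (m + 1) (BraidGroup.shift (m + 1) b) u) = braidAut m b (FS1.δ 0 u) :=
  δ_braidAut (φ := BraidGroup.shift (m + 1)) (ψ := MonoidHom.id _) (fun (k : Fin m) u => by
    rw [braidAut_shift_gen, MonoidHom.id_apply, braidAut_gen]
    exact δ_sigma_lt k 0 (Nat.zero_le _) u) b u

lemma δ_one_braidAut_shift_shift (b : BraidGroup (m + 1)) (u : FS1 _⦋m + 2⦌) :
    FS1.δ 1 (braidAut (m + 2) (BraidGroup.shift (m + 2) (BraidGroup.shift (m + 1) b)) u) =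
      braidAut (m + 1) (BraidGroup.shift (m + 1) b) (FS1.δ 1 u) :=
  δ_braidAut (φ := (BraidGroup.shift (m + 2)).comp (BraidGroup.shift (m + 1)))
    (ψ := BraidGroup.shift (m + 1)) (fun (k : Fin m) u => by
      rw [MonoidHom.comp_apply, braidAut_shift_gen, BraidGroup.shift_gen, braidAut_shift_gen]
      exact δ_sigma_lt k.succ 1 (by simp) u) b u

lemma δ_braidAut_of_smul_eq {b : BraidGroup (m + 1 + 1)} {u : FS1 _⦋m + 1⦌}
    (h : b • (QuotientGroup.mk u : modBoundaries FS1 (m + 1)) = QuotientGroup.mk u)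
    (j : Fin (m + 2)) : FS1.δ j (braidAut (m + 1) b u) = FS1.δ j u := by
  have hδ := (mem_cycles_succ FS1 _).1
    (boundaries_le_cycles FS1 _ (QuotientGroup.eq.1 ((smul_mk b u).symm.trans h))) j
  rwa [map_mul, map_inv, inv_mul_eq_one] at hδ

lemma eq_one_of_mem_fixedPoints {v : FS1 _⦋m + 2⦌}
    (hv : v ∈ MulAction.fixedPoints ((BraidGroup.pure (m + 3)).map (braidAut (m + 2)))
      (FS1 _⦋m + 2⦌)) : v = 1 := by
  have hpow {w : FS1 _⦋m + 2⦌}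
      (hw : w ∈ MulAction.fixedPoints ((BraidGroup.pure (m + 3)).map (braidAut (m + 2)))
        (FS1 _⦋m + 2⦌)) : w ∈ Subgroup.zpowers (y 0) :=
    mem_zpowers_y_zero_of_braidAut_shift_fullTwist (hw ⟨_, _,
      BraidGroup.shift_mem_pure (BraidGroup.fullTwist_mem_pure (m + 1)), rfl⟩)
  -- The set of fixed points is stable under `sigma 0`, which turns `y 0 ^ a` into `y 1 ^ a`.
  obtain ⟨a, rfl⟩ := hpow hv
  obtain ⟨c, hc⟩ : sigma 0 (y 0 ^ a) ∈ Subgroup.zpowers (y 0) := by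
    rw [← braidAut_gen]
    exact hpow (map_smul_mem_fixedPoints_map (braidAut (m + 2)) hv _)
  have hc : y 0 ^ c = y 1 ^ a := hc.trans ((map_zpow _ _ a).trans
    (congrArg (· ^ a) (sigma_y_self 0)))
  have ha := congrArg (degree 1) hc
  have hy : degree 1 (y 1 : FS1 _⦋m + 2⦌) = _ := degree_y_castSucc 1
  rw [map_zpow, map_zpow, degree_y_of_lt (by simp), one_zpow, hy, ← ofAdd_zsmul, eq_comm,
    ofAdd_eq_one, zsmul_one, Int.cast_id] at ha
  exact ha ▸ zpow_zero _

/-! ### Elements fixed by pure braids -/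

lemma δ_zero_eq_one_of_mem_fixedPoints {u : FS1 _⦋m + 3⦌}
    (hu : QuotientGroup.mk u ∈ MulAction.fixedPoints
      ((BraidGroup.pure (m + 3)).map (BraidGroup.shift (m + 3))) (modBoundaries FS1 (m + 3))) :
    FS1.δ 0 u = 1 := by
  refine eq_one_of_mem_fixedPoints ?_
  rintro ⟨_, b, hb, rfl⟩
  exact (δ_zero_braidAut_shift b u).symm.trans (δ_braidAut_of_smul_eq (hu ⟨_, b, hb, rfl⟩) 0)

lemma mem_cycles_of_mem_fixedPoints {u : FS1 _⦋m + 3⦌}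
    (hu : QuotientGroup.mk u ∈
      MulAction.fixedPoints (BraidGroup.pure (m + 4)) (modBoundaries FS1 (m + 3))) :
    u ∈ cycles FS1 (m + 3) := by
  rw [mem_cycles_succ]
  intro j
  induction j using Fin.induction generalizing u with
  | zero =>
    refine δ_zero_eq_one_of_mem_fixedPoints ?_
    rintro ⟨_, b, hb, rfl⟩
    exact hu ⟨_, BraidGroup.shift_mem_pure hb⟩
  | succ k ih =>
    rw [← δ_sigma_self]
    refine ih ?_
    rw [← braidAut_gen, ← smul_mk]
    exact smul_mem_fixedPoints_of_mem_normalizer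
      (by simp [Subgroup.normalizer_eq_top (BraidGroup.pure (m + 4))]) hu

lemma δ_succ_mem_zpowers_of_mem_fixedPoints {u : FS1 _⦋m + 2⦌}
    (hu : QuotientGroup.mk u ∈ MulAction.fixedPoints
      ((BraidGroup.pure (m + 2)).map (BraidGroup.shift (m + 2))) (modBoundaries FS1 (m + 2)))
    (j : Fin (m + 2)) : FS1.δ j.succ u ∈ Subgroup.zpowers (y 0) := by
  induction j using Fin.induction generalizing u with
  | zero =>
    refine mem_zpowers_y_zero_of_braidAut_shift_fullTwist ?_
    refine (δ_one_braidAut_shift_shift _ u).symm.trans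
      (δ_braidAut_of_smul_eq (hu ⟨_, _, ?_, rfl⟩) 1)
    exact BraidGroup.shift_mem_pure (BraidGroup.fullTwist_mem_pure m)
  | succ k ih =>
    rw [← δ_sigma_self]
    refine ih ?_
    rw [← braidAut_shift_gen, ← smul_mk]
    exact map_smul_mem_fixedPoints_map (BraidGroup.shift (m + 2)) hu _

lemma exists_zpow_mul_mem_cycles_of_mem_fixedPoints {u : FS1 _⦋m + 3⦌}
    (hu : QuotientGroup.mk u ∈ MulAction.fixedPoints
      ((BraidGroup.pure (m + 3)).map (BraidGroup.shift (m + 3))) (modBoundaries FS1 (m + 3))) :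
    ∃ k : ℤ, y 0 ^ (-k) * u ∈ cycles FS1 (m + 3) := by
  have hpow := δ_succ_mem_zpowers_of_mem_fixedPoints hu
  obtain ⟨k, hk⟩ := hpow 0
  have hδ (j : Fin (m + 3)) : FS1.δ j.succ u = y 0 ^ k := by
    obtain ⟨l, hl⟩ := hpow j
    cases j using Fin.cases with
    | zero => exact hk.symm
    | succ j =>
      have h := δ_δ_of_le FS1 (i := 1) (j := j.succ) (by simp [Fin.le_def]) u
      have hk' : FS1.δ (Fin.castSucc 1) u = y 0 ^ k := hk.symm
      have hone : FS1.δ 1 (y 0 : FS1 _⦋m + 2⦌) = y 0 := δ_succ_y_zero 0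
      rw [hk', ← hl, map_zpow, map_zpow, hone, δ_succ_y_zero] at h
      rw [← hl, y_zero_zpow_injective h]
  refine ⟨k, (mem_cycles_succ FS1 _).2 fun j => ?_⟩
  rw [map_mul, map_zpow]
  cases j using Fin.cases with
  | zero => rw [δ_zero_y_zero, one_zpow, one_mul, δ_zero_eq_one_of_mem_fixedPoints hu]
  | succ j => rw [δ_succ_y_zero, hδ, zpow_neg, inv_mul_cancel]

lemma commute_mk_y_zero_of_mem_range {q : modBoundaries FS1 (m + 1)}
    (hq : q ∈ (homotopyIncl FS1 (m + 1)).range) :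
    Commute (QuotientGroup.mk (y 0) : modBoundaries FS1 (m + 1)) q := by
  have h := smul_eq_self_of_mem_pure
    (BraidGroup.shift_mem_pure (BraidGroup.fullTwist_mem_pure m)) hq
  obtain ⟨u, rfl⟩ := QuotientGroup.mk_surjective q
  rw [smul_mk, braidAut_shift_fullTwist, MulAut.conj_apply, QuotientGroup.mk_mul,
    QuotientGroup.mk_inv, mul_inv_eq_iff_eq_mul, QuotientGroup.mk_mul] at h
  exact h

/-- The homomorphism `(k, z) ↦ y_{-1}^k z`, with `ℤ` written multiplicatively; its range is the
fixed subgroup of `K_{m+1}`. -/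
noncomputable def zpowMulIncl (m : ℕ) :
    Multiplicative ℤ × homotopyGroup FS1 (m + 1) →* modBoundaries FS1 (m + 1) :=
  (zpowersHom _ (QuotientGroup.mk (y 0))).noncommCoprod (homotopyIncl FS1 (m + 1))
    fun k z => (commute_mk_y_zero_of_mem_range ⟨z, rfl⟩).zpow_left k.toAdd

lemma zpowMulIncl_apply (k : Multiplicative ℤ) (z : homotopyGroup FS1 (m + 1)) :
    zpowMulIncl m (k, z) = QuotientGroup.mk (y 0) ^ k.toAdd * homotopyIncl FS1 (m + 1) z :=
  rfl

lemma mk_y_zero_zpow_mem_range {k : ℤ} :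
    (QuotientGroup.mk (y 0) ^ k : modBoundaries FS1 (m + 2)) ∈ (homotopyIncl FS1 (m + 2)).range ↔
      k = 0 := by
  rw [← QuotientGroup.mk_zpow, mk_mem_range_homotopyIncl]
  refine ⟨fun h => ?_, fun h => h ▸ one_mem _⟩
  have hδ := (mem_cycles_succ FS1 _).1 h (Fin.succ 0)
  rw [map_zpow, δ_succ_y_zero] at hδ
  exact y_zero_zpow_injective (hδ.trans (zpow_zero _).symm)

lemma zpowMulIncl_injective (m : ℕ) : Function.Injective (zpowMulIncl (m + 1)) := by
  refine (injective_iff_map_eq_one _).2 fun ⟨k, z⟩ h => ?_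
  have hk : k = 1 := mk_y_zero_zpow_mem_range.1
    ⟨z⁻¹, (map_inv _ z).trans (eq_inv_of_mul_eq_one_left h).symm⟩
  subst hk
  have hz : homotopyIncl FS1 (m + 2) z = 1 := by
    rwa [zpowMulIncl_apply, toAdd_one, zpow_zero, one_mul] at h
  rw [(map_eq_one_iff _ (homotopyIncl_injective FS1 _)).1 hz]
  rfl

lemma range_zpowMulIncl (m : ℕ) :
    (zpowMulIncl (m + 2)).range = FixedPoints.subgroup
      ((BraidGroup.pure (m + 3)).map (BraidGroup.shift (m + 3))) (modBoundaries FS1 (m + 3)) := by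
  apply le_antisymm
  · rintro _ ⟨⟨k, z⟩, rfl⟩ ⟨_, b, hb, rfl⟩
    have hy : BraidGroup.shift (m + 3) b • (QuotientGroup.mk (y 0) : modBoundaries FS1 (m + 3)) =
        QuotientGroup.mk (y 0) := by
      rw [smul_mk, braidAut_shift_y_zero]
    change BraidGroup.shift (m + 3) b • zpowMulIncl (m + 2) (k, z) = zpowMulIncl (m + 2) (k, z)
    rw [zpowMulIncl_apply, smul_mul', smul_zpow', hy,
      smul_eq_self_of_mem_pure (BraidGroup.shift_mem_pure hb) ⟨z, rfl⟩]
  · intro q hq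
    obtain ⟨u, rfl⟩ := QuotientGroup.mk_surjective q
    obtain ⟨k, hk⟩ := exists_zpow_mul_mem_cycles_of_mem_fixedPoints hq
    obtain ⟨z, hz⟩ := (mk_mem_range_homotopyIncl FS1 _).2 hk
    refine ⟨(Multiplicative.ofAdd k, z), ?_⟩
    rw [zpowMulIncl_apply, toAdd_ofAdd, hz, QuotientGroup.mk_mul, QuotientGroup.mk_zpow, zpow_neg,
      mul_inv_cancel_left]

lemma fixedPoints_pure_eq_range_homotopyIncl (m : ℕ) :
    FixedPoints.subgroup (BraidGroup.pure (m + 4)) (modBoundaries FS1 (m + 3)) =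
      (homotopyIncl FS1 (m + 3)).range := by
  refine le_antisymm (fun q hq => ?_) fun q hq b => smul_eq_self_of_mem_pure b.2 hq
  obtain ⟨u, rfl⟩ := QuotientGroup.mk_surjective q
  exact (mk_mem_range_homotopyIncl FS1 u).2 (mem_cycles_of_mem_fixedPoints hq)

end FS1

end

theorem theorem2p11 (n : ℕ) (hn : 2 ≤ n) :
    Function.Injective (SimplicialGroup.homotopyIncl FS1 (n + 1)) ∧
    (∃ e : Multiplicative ℤ × SimplicialGroup.homotopyGroup FS1 (n + 1) ≃*
        FixedPoints.subgroup ((BraidGroup.pure (n + 1)).map (BraidGroup.shift (n + 1)))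
          (SimplicialGroup.modBoundaries FS1 (n + 1)),
      ∀ (k : ℤ) (z : SimplicialGroup.homotopyGroup FS1 (n + 1)),
        (e (Multiplicative.ofAdd k, z) : SimplicialGroup.modBoundaries FS1 (n + 1)) =
          QuotientGroup.mk (FS1.y 0) ^ k * SimplicialGroup.homotopyIncl FS1 (n + 1) z) ∧
    FixedPoints.subgroup (BraidGroup.pure (n + 2))
        (SimplicialGroup.modBoundaries FS1 (n + 1)) =
      (SimplicialGroup.homotopyIncl FS1 (n + 1)).range := by
  obtain ⟨m, rfl⟩ := Nat.exists_eq_add_of_le' hn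
  exact ⟨SimplicialGroup.homotopyIncl_injective FS1 (m + 3),
    ⟨(MonoidHom.ofInjective (FS1.zpowMulIncl_injective (m + 1))).trans
      (MulEquiv.subgroupCongr (FS1.range_zpowMulIncl m)), fun _ _ => rfl⟩,
    FS1.fixedPoints_pure_eq_range_homotopyIncl m⟩
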